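/- Let $N\ge 1$ be an integer and let $T_{N-1}(w)=\sum_{k=0}^{N-1} w^k/k!$. Let $\delta>0$ be such that $w=0$ is the only root of $e^w-T_{N-1}(w)=0$ in the closed disc $|w|\le\delta$ (this holds for all sufficiently small $\delta>0$). For $s\in\mathbb{C}$ let $$I_N(s)=\frac{1}{2\pi i}\int_\gamma \frac{(-w)^{s+N-1}}{e^w-T_{N-1}(w)}\,\frac{dw}{w},$$ where the contour $\gamma$ runs along the real axis from $\infty$ to $\delta$ (with $\arg(-w)=-\pi$), then once counterclockwise around the circle $|w|=\delta$ (with $\arg(-w)$ increasing continuously from $-\pi$ to $\pi$), and then along the real axis from $\delta$ to $\infty$ (with $\arg(-w)=\pi$). For $\operatorname{Re}(s)>1$ let $$\zeta_N(s)=\frac{1}{\Gamma(s+N-1)}\int_0^\infty\frac{x^{s+N-2}}{e^x-T_{N-1}(x)}\,dx.$$ Then the integral $I_N(s)$ converges absolutely for every $s\in\mathbb{C}$ and defines an entire function. The integral defining $\zeta_N(s)$ converges absolutely for $\operatorname{Re}(s)>1$, and $\zeta_N(s)=\Gamma(2-s-N)\,I_N(s)$ for all non-integer $s$ with $\operatorname{Re}(s)>1$.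 Moreover, $$I_N'(1)=(-1)^N\,(N-1)!\,\log(N!).$$ -/

import Mathlib

open Filter Topology MeasureTheory Set

noncomputable section

/-- `expDiff N w = e^w - T_{N-1}(w)`, where `T_{N-1}(w) = ∑_{k < N} w^k / k!` is the Maclaurin
polynomial of degree `N - 1` of the exponential function. -/
def expDiff (N : ℕ) (w : ℂ) : ℂ :=
  Complex.exp w - ∑ k ∈ Finset.range N, w ^ k / (k.factorial : ℂ)

/-- The integrand `x^{s+N-2} / (e^x - T_{N-1}(x))`, `x > 0`, of the hypergeometric zeta function. -/
def hyperzetaIntegrand (N : ℕ) (s : ℂ) (x : ℝ) : ℂ :=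
  (x : ℂ) ^ (s + N - 2) / expDiff N x

/-- The hypergeometric zeta function of order `N`,
`ζ_N(s) = Γ(s+N-1)⁻¹ ∫_0^∞ x^{s+N-2} / (e^x - T_{N-1}(x)) dx`, meant for `Re s > 1`. -/
def hyperzeta (N : ℕ) (s : ℂ) : ℂ :=
  1 / Complex.Gamma (s + N - 1) * ∫ x in Ioi (0 : ℝ), hyperzetaIntegrand N s x

/-- The integrand `(e^w - T_{N-1}(w))⁻¹ (-w)^{s+N-1} / w` at the point `w`, where the power is
`(-w)^{s+N-1} = exp ((s+N-1) l)` for the branch `l` of `log (-w)` selected by the contour. -/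
def hankelIntegrand (N : ℕ) (s w l : ℂ) : ℂ :=
  (expDiff N w)⁻¹ * Complex.exp ((s + N - 1) * l) / w

/-- The integrand on the incoming ray, where `-w = x e^{-iπ}`, i.e. `w = x`. -/
def hankelIn (N : ℕ) (s : ℂ) (x : ℝ) : ℂ :=
  hankelIntegrand N s x (Real.log x - Real.pi * Complex.I)

/-- The integrand on the outgoing ray, where `-w = x e^{iπ}`, i.e. `w = x`. -/
def hankelOut (N : ℕ) (s : ℂ) (x : ℝ) : ℂ :=
  hankelIntegrand N s x (Real.log x + Real.pi * Complex.I)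

/-- The point of the circle `|w| = δ` with `-w = δ e^{iφ}`; as `φ` runs from `-π` to `π` the circle
is traversed once counterclockwise, from `δ` to `δ`. -/
def hankelPoint (δ φ : ℝ) : ℂ :=
  -((δ : ℂ) * Complex.exp (φ * Complex.I))

/-- The integrand on the circle `|w| = δ`, multiplied by `dw/dφ = i w`. -/
def hankelCirc (N : ℕ) (δ : ℝ) (s : ℂ) (φ : ℝ) : ℂ :=
  hankelIntegrand N s (hankelPoint δ φ) (Real.log δ + φ * Complex.I) *
    (Complex.I * hankelPoint δ φ)

/-- The contour integral
`I_N(s) = (2πi)⁻¹ ∫_γ (e^w - T_{N-1}(w))⁻¹ (-w)^{s+N-1} dw/w`, where `γ` comes in along the real axis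
from `∞` to `δ` (with `arg (-w) = -π`), runs counterclockwise around the circle `|w| = δ`, and
goes back along the real axis from `δ` to `∞` (with `arg (-w) = π`). -/
def hankelI (N : ℕ) (δ : ℝ) (s : ℂ) : ℂ :=
  1 / (2 * Real.pi * Complex.I) *
    (-(∫ x in Ioi δ, hankelIn N s x) + (∫ φ in (-Real.pi)..Real.pi, hankelCirc N δ s φ)
      + ∫ x in Ioi δ, hankelOut N s x)

/-- The radii `δ > 0` such that `0` is the only root of `e^w = T_{N-1}(w)` in `|w| ≤ δ`. -/
def AdmissibleRadius (N : ℕ) (δ : ℝ) : Prop :=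
  0 < δ ∧ ∀ w : ℂ, ‖w‖ ≤ δ → expDiff N w = 0 → w = 0

end

/-! Write `E = e^w - T_{N-1}(w)`. In the coordinate `l = log (-w)` the integrand is holomorphic on
`Re l ≤ log δ`, so Cauchy's theorem on a rectangle makes `hankelI` independent of the radius
(`AdmissibleRadius.hankelI_eq`). The two rays together give `2i sin(π(s+N-1))` times a Mellin
transform of `1/E` cut off at `δ`, which is entire in `s`; the circle is entire as well.

For `Re s > 1` the circle vanishes as the radius tends to `0`, leaving `sin(π(s+N-1))/π` times the
zeta integral; Euler's reflection formula turns this into the Gamma factor.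

At `s = 1` the sine vanishes, so only the value of the Mellin transform enters the derivative. It is
elementary, since `E' = E + x^(N-1)/(N-1)!` makes `(N-1)! (log E(x) - x)` a primitive of
`x^(N-1)/E(x)`. As the radius `ε` tends to `0`, its term `-log E(ε)` and the term `N log ε` from the
circle combine to `log (ε^N/E(ε))`, which tends to `log N!`. -/

/-! ### Estimates for `e^w - T_{N-1}(w)` -/

/-- The real version of `expDiff`. -/
noncomputable def realExpDiff (N : ℕ) (x : ℝ) : ℝ :=
  Real.exp x - ∑ k ∈ Finset.range N, x ^ k / (k.factorial : ℝ)

theorem expDiff_ofReal (N : ℕ) (x : ℝ) : expDiff N x = (realExpDiff N x : ℂ) := by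
  simp [expDiff, realExpDiff]

theorem pow_div_factorial_le_realExpDiff {N n : ℕ} (h : N ≤ n) {x : ℝ} (hx : 0 ≤ x) :
    x ^ n / (n.factorial : ℝ) ≤ realExpDiff N x := by
  have h1 := Real.sum_le_exp_of_nonneg hx (n + 1)
  rw [Finset.sum_range_succ] at h1
  have h2 : ∑ k ∈ Finset.range N, x ^ k / (k.factorial : ℝ)
      ≤ ∑ k ∈ Finset.range n, x ^ k / (k.factorial : ℝ) :=
    Finset.sum_le_sum_of_subset_of_nonneg (Finset.range_mono h) fun _ _ _ => by positivity
  unfold realExpDiff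
  linarith

theorem realExpDiff_pos (N : ℕ) {x : ℝ} (hx : 0 < x) : 0 < realExpDiff N x :=
  lt_of_lt_of_le (by positivity) (pow_div_factorial_le_realExpDiff le_rfl hx.le)

theorem expDiff_ofReal_ne_zero (N : ℕ) {x : ℝ} (hx : 0 < x) : expDiff N x ≠ 0 := by
  rw [expDiff_ofReal]
  exact_mod_cast (realExpDiff_pos N hx).ne'

theorem norm_inv_expDiff_ofReal_le {N n : ℕ} (h : N ≤ n) {x : ℝ} (hx : 0 < x) :
    ‖(expDiff N x)⁻¹‖ ≤ n.factorial * (x ^ n)⁻¹ := by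
  rw [expDiff_ofReal, norm_inv, Complex.norm_real, Real.norm_of_nonneg (realExpDiff_pos N hx).le]
  refine (inv_anti₀ (by positivity) (pow_div_factorial_le_realExpDiff h hx.le)).trans_eq ?_
  rw [inv_div, div_eq_mul_inv]

theorem differentiable_expDiff (N : ℕ) : Differentiable ℂ (expDiff N) := by
  unfold expDiff
  fun_prop

theorem hasDerivAt_realExpDiff_succ (M : ℕ) (x : ℝ) :
    HasDerivAt (realExpDiff (M + 1)) (realExpDiff (M + 1) x + x ^ M / (M.factorial : ℝ)) x := by
  induction M with
  | zero =>
    have : realExpDiff 1 = fun x => Real.exp x - 1 := by ext; simp [realExpDiff]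
    rw [this]
    simpa using (Real.hasDerivAt_exp x).sub_const 1
  | succ M ih =>
    have h (M : ℕ) (x : ℝ) :
        realExpDiff (M + 1) x = realExpDiff M x - x ^ M / (M.factorial : ℝ) := by
      simp [realExpDiff, Finset.sum_range_succ, sub_sub]
    have h' : realExpDiff (M + 1 + 1) =
        fun x => realExpDiff (M + 1) x - x ^ (M + 1) / ((M + 1).factorial : ℝ) := by
      ext x
      exact h _ _
    rw [h']
    refine (ih.sub ((hasDerivAt_pow (M + 1) x).div_const ((M + 1).factorial : ℝ))).congr_deriv ?_
    rw [Nat.factorial_succ]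
    push_cast
    field_simp
    ring

/-- Near `0` the Taylor remainder beyond `w^N/N!` is at most half of that term. The linear error
governs both circle limits, and the nonvanishing gives admissible radii. -/
theorem exists_norm_pow_div_expDiff_sub_le (N : ℕ) :
    ∃ C r : ℝ, 0 ≤ C ∧ 0 < r ∧ ∀ w : ℂ, w ≠ 0 → ‖w‖ ≤ r →
      expDiff N w ≠ 0 ∧ ‖w ^ N / expDiff N w - (N.factorial : ℂ)‖ ≤ C * ‖w‖ := by
  set f : ℝ := (N.factorial : ℝ) with hf
  have hf0 : 0 < f := by positivity
  set K : ℝ := ((N + 1).succ : ℝ) * ((N + 1).factorial * (N + 1 : ℕ) : ℝ)⁻¹ with hK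
  have hK0 : 0 < K := by positivity
  -- `K` is the constant of `Complex.exp_bound` with `N + 1` terms; the radius makes `‖w‖ * K ≤ 1 /
  -- (2 * f)`.
  refine ⟨2 * f ^ 2 * K, min 1 (1 / (2 * f * K)), by positivity, by positivity,
    fun w hw0 hw => ?_⟩
  have hu : 0 < ‖w‖ := norm_pos_iff.2 hw0
  have hA : ‖expDiff N w - w ^ N / (N.factorial : ℂ)‖ ≤ ‖w‖ ^ (N + 1) * K := by
    have := Complex.exp_bound (hw.trans (min_le_left _ _)) N.succ_pos
    rwa [Nat.succ_eq_add_one, Finset.sum_range_succ, ← sub_sub] at this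
  have hr : ‖w‖ * K ≤ 1 / (2 * f) := by
    have := mul_le_mul_of_nonneg_right (hw.trans (min_le_right _ _)) hK0.le
    refine this.trans_eq ?_
    field_simp
  have hB : ‖w‖ ^ N / (2 * f) ≤ ‖expDiff N w‖ := by
    have h1 : ‖w ^ N / (N.factorial : ℂ)‖ = ‖w‖ ^ N / f := by simp [hf]
    have h2 := norm_sub_norm_le (w ^ N / (N.factorial : ℂ)) (expDiff N w)
    rw [norm_sub_rev, h1] at h2
    have h3 : ‖w‖ ^ (N + 1) * K ≤ ‖w‖ ^ N * (1 / (2 * f)) := by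
      rw [pow_succ, mul_assoc]
      gcongr
    have h4 : ‖w‖ ^ N / f = ‖w‖ ^ N / (2 * f) + ‖w‖ ^ N * (1 / (2 * f)) := by
      field_simp
      norm_num
    linarith
  have hD : 0 < ‖expDiff N w‖ := lt_of_lt_of_le (by positivity) hB
  have hD0 : expDiff N w ≠ 0 := norm_pos_iff.1 hD
  refine ⟨hD0, ?_⟩
  have hN0 : (N.factorial : ℂ) ≠ 0 := by exact_mod_cast N.factorial_ne_zero
  have h5 : w ^ N / expDiff N w - (N.factorial : ℂ) =
      -((N.factorial : ℂ) * (expDiff N w - w ^ N / (N.factorial : ℂ)) / expDiff N w) := by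
    field_simp
    ring
  rw [h5, norm_neg, norm_div, norm_mul, div_le_iff₀ hD, Complex.norm_natCast, ← hf]
  calc f * ‖expDiff N w - w ^ N / (N.factorial : ℂ)‖ ≤ f * (‖w‖ ^ (N + 1) * K) := by gcongr
    _ = 2 * f ^ 2 * K * ‖w‖ * (‖w‖ ^ N / (2 * f)) := by
      field_simp
      ring
    _ ≤ _ := by gcongr

theorem eventually_admissibleRadius (N : ℕ) :
    ∀ᶠ δ in 𝓝[>] (0 : ℝ), AdmissibleRadius N δ := by
  obtain ⟨C, r, -, hr, h⟩ := exists_norm_pow_div_expDiff_sub_le N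
  filter_upwards [Ioc_mem_nhdsGT hr] with δ hδ
  refine ⟨hδ.1, fun w hw h0 => ?_⟩
  by_contra hne
  exact (h w hne (hw.trans hδ.2)).1 h0

theorem AdmissibleRadius.mono {N : ℕ} {ε δ : ℝ} (h : AdmissibleRadius N δ) (hε : 0 < ε)
    (hεδ : ε ≤ δ) : AdmissibleRadius N ε :=
  ⟨hε, fun w hw => h.2 w (hw.trans hεδ)⟩

theorem tendsto_pow_div_realExpDiff (N : ℕ) :
    Tendsto (fun x : ℝ => x ^ N / realExpDiff N x) (𝓝[>] 0) (𝓝 (N.factorial : ℝ)) := by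
  obtain ⟨C, r, -, hr, h⟩ := exists_norm_pow_div_expDiff_sub_le N
  rw [tendsto_iff_norm_sub_tendsto_zero]
  have hC : Tendsto (fun x : ℝ => C * x) (𝓝[>] 0) (𝓝 0) := by
    have : Tendsto (fun x : ℝ => C * x) (𝓝 0) (𝓝 (C * 0)) := (continuous_const_mul C).tendsto 0
    rw [mul_zero] at this
    exact this.mono_left nhdsWithin_le_nhds
  refine squeeze_zero' (Eventually.of_forall fun _ => norm_nonneg _) ?_ hC
  filter_upwards [Ioc_mem_nhdsGT hr] with x hx
  have hnx : ‖(x : ℂ)‖ = x := by rw [Complex.norm_real, Real.norm_of_nonneg hx.1.le]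
  have := (h x (by exact_mod_cast hx.1.ne') (hnx.trans_le hx.2)).2
  rw [hnx, expDiff_ofReal] at this
  refine le_trans (le_of_eq ?_) this
  rw [← Complex.norm_real]
  push_cast
  rfl

theorem tendsto_log_realExpDiff_sub (N : ℕ) :
    Tendsto (fun x : ℝ => Real.log (realExpDiff N x) - x) atTop (𝓝 0) := by
  have h1 : Tendsto (fun x : ℝ => realExpDiff N x * Real.exp (-x)) atTop (𝓝 1) := by
    have h2 : Tendsto (fun x : ℝ => 1 - ∑ k ∈ Finset.range N,
        x ^ k * Real.exp (-x) * (k.factorial : ℝ)⁻¹) atTop (𝓝 (1 - ∑ k ∈ Finset.range N,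
        0 * (k.factorial : ℝ)⁻¹)) :=
      tendsto_const_nhds.sub (tendsto_finsetSum _ fun k _ =>
        (Real.tendsto_pow_mul_exp_neg_atTop_nhds_zero k).mul_const _)
    simp only [zero_mul, Finset.sum_const_zero, sub_zero] at h2
    refine h2.congr fun x => ?_
    rw [realExpDiff, sub_mul, ← Real.exp_add, add_neg_cancel, Real.exp_zero, Finset.sum_mul]
    congr 1
    exact Finset.sum_congr rfl fun k _ => by ring
  have h3 := h1.log one_ne_zero
  rw [Real.log_one] at h3
  refine h3.congr' ?_
  filter_upwards [eventually_gt_atTop 0] with x hx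
  rw [Real.log_mul (realExpDiff_pos N hx).ne' (Real.exp_pos _).ne', Real.log_exp, sub_eq_add_neg]

/-! ### The rays as a Mellin transform -/

/-- The function `1 / (e^x - T_{N-1}(x))` cut off to `x > δ`, whose Mellin transform gives the
contribution of the rays. -/
noncomputable def truncInvExpDiff (N : ℕ) (δ : ℝ) : ℝ → ℂ :=
  (Ioi δ).indicator fun x => (expDiff N x)⁻¹

theorem locallyIntegrableOn_truncInvExpDiff (N : ℕ) (δ : ℝ) :
    LocallyIntegrableOn (truncInvExpDiff N δ) (Ioi 0) := by
  have h : ContinuousOn (fun x : ℝ => (expDiff N x)⁻¹) (Ioi 0) :=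
    (((differentiable_expDiff N).continuous.comp Complex.continuous_ofReal).continuousOn).inv₀
      fun x hx => expDiff_ofReal_ne_zero N hx
  intro x hx
  obtain ⟨t, ht, hi⟩ := (h.locallyIntegrableOn (μ := volume) measurableSet_Ioi) x hx
  exact ⟨t, ht, hi.indicator measurableSet_Ioi⟩

theorem norm_truncInvExpDiff_le {N n : ℕ} (h : N ≤ n) (δ : ℝ) {x : ℝ} (hx : 0 < x) :
    ‖truncInvExpDiff N δ x‖ ≤ n.factorial * (x ^ n)⁻¹ :=
  (norm_indicator_le_norm_self _ _).trans (norm_inv_expDiff_ofReal_le h hx)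

/-- Every Taylor term `x^n/n!` with `n ≥ N` is a lower bound for the denominator, so the decay beats
any power. -/
theorem truncInvExpDiff_isBigO_atTop (N : ℕ) (δ a : ℝ) :
    truncInvExpDiff N δ =O[atTop] fun x : ℝ => x ^ (-a) := by
  obtain ⟨n, hn⟩ := exists_nat_ge a
  refine Asymptotics.IsBigO.of_bound ((max N n).factorial : ℝ) ?_
  filter_upwards [eventually_ge_atTop 1] with x hx
  have hx0 : 0 < x := one_pos.trans_le hx
  refine (norm_truncInvExpDiff_le (le_max_left N n) δ hx0).trans ?_
  rw [Real.norm_of_nonneg (by positivity), ← Real.rpow_natCast, ← Real.rpow_neg hx0.le]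
  gcongr
  exact hn.trans (by exact_mod_cast le_max_right N n)

theorem truncInvExpDiff_isBigO_zero (N : ℕ) (δ : ℝ) :
    truncInvExpDiff N δ =O[𝓝[>] 0] fun x : ℝ => x ^ (-(N : ℝ)) := by
  refine Asymptotics.IsBigO.of_bound (N.factorial : ℝ) ?_
  filter_upwards [self_mem_nhdsWithin] with x hx
  have hx0 : 0 < x := hx
  refine (norm_truncInvExpDiff_le le_rfl δ hx0).trans_eq ?_
  rw [Real.norm_of_nonneg (by positivity), Real.rpow_neg hx0.le, Real.rpow_natCast]

theorem truncInvExpDiff_isBigO_zero_of_pos (N : ℕ) {δ : ℝ} (hδ : 0 < δ) (b : ℝ) :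
    truncInvExpDiff N δ =O[𝓝[>] 0] fun x : ℝ => x ^ (-b) := by
  refine Asymptotics.IsBigO.of_bound 0 ?_
  filter_upwards [Ioc_mem_nhdsGT hδ] with x hx
  have : x ∉ Ioi δ := not_lt.2 hx.2
  simp [truncInvExpDiff, this]

theorem mellinConvergent_truncInvExpDiff (N : ℕ) {δ : ℝ} (hδ : 0 < δ) (z : ℂ) :
    MellinConvergent (truncInvExpDiff N δ) z :=
  mellinConvergent_of_isBigO_rpow (locallyIntegrableOn_truncInvExpDiff N δ)
    (truncInvExpDiff_isBigO_atTop N δ (z.re + 1)) (by linarith)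
    (truncInvExpDiff_isBigO_zero_of_pos N hδ (z.re - 1)) (by linarith)

theorem differentiable_mellin_truncInvExpDiff (N : ℕ) {δ : ℝ} (hδ : 0 < δ) :
    Differentiable ℂ (mellin (truncInvExpDiff N δ)) := fun z =>
  mellin_differentiableAt_of_isBigO_rpow (locallyIntegrableOn_truncInvExpDiff N δ)
    (truncInvExpDiff_isBigO_atTop N δ (z.re + 1)) (by linarith)
    (truncInvExpDiff_isBigO_zero_of_pos N hδ (z.re - 1)) (by linarith)

theorem integrableOn_cpow_mul_inv_expDiff (N : ℕ) {δ : ℝ} (hδ : 0 < δ) (z : ℂ) :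
    IntegrableOn (fun x : ℝ => (x : ℂ) ^ (z - 1) * (expDiff N x)⁻¹) (Ioi δ) := by
  refine ((mellinConvergent_truncInvExpDiff N hδ z).mono_set (Ioi_subset_Ioi hδ.le)).congr_fun
    (fun x hx => ?_) measurableSet_Ioi
  simp [truncInvExpDiff, indicator_of_mem hx]

theorem mellin_truncInvExpDiff (N : ℕ) {δ : ℝ} (hδ : 0 ≤ δ) (z : ℂ) :
    mellin (truncInvExpDiff N δ) z = ∫ x in Ioi δ, (x : ℂ) ^ (z - 1) * (expDiff N x)⁻¹ := by
  have h : (fun x : ℝ => (x : ℂ) ^ (z - 1) • truncInvExpDiff N δ x) =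
      (Ioi δ).indicator fun x : ℝ => (x : ℂ) ^ (z - 1) * (expDiff N x)⁻¹ := by
    ext x
    by_cases hx : x ∈ Ioi δ <;> simp [truncInvExpDiff, hx]
  rw [mellin, h, setIntegral_indicator measurableSet_Ioi, Ioi_inter_Ioi, sup_of_le_right hδ]

theorem hyperzetaIntegrand_eq (N : ℕ) (s : ℂ) (x : ℝ) :
    hyperzetaIntegrand N s x = (x : ℂ) ^ ((s + N - 1) - 1) * (expDiff N x)⁻¹ := by
  rw [hyperzetaIntegrand, div_eq_mul_inv]
  congr 2
  ring

theorem integrableOn_hyperzetaIntegrand (N : ℕ) {s : ℂ} (hs : 1 < s.re) :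
    IntegrableOn (hyperzetaIntegrand N s) (Ioi 0) := by
  have h : MellinConvergent (truncInvExpDiff N 0) (s + N - 1) :=
    mellinConvergent_of_isBigO_rpow (locallyIntegrableOn_truncInvExpDiff N 0)
      (truncInvExpDiff_isBigO_atTop N 0 ((s + N - 1).re + 1)) (by linarith)
      (truncInvExpDiff_isBigO_zero N 0) (by simp; linarith)
  refine h.congr_fun (fun x hx => ?_) measurableSet_Ioi
  simp [truncInvExpDiff, indicator_of_mem hx, hyperzetaIntegrand_eq]

theorem exp_mul_log_ofReal_add (z θ : ℂ) {x : ℝ} (hx : 0 < x) :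
    Complex.exp (z * (Real.log x + θ)) / x = Complex.exp (z * θ) * (x : ℂ) ^ (z - 1) := by
  have hx0 : (x : ℂ) ≠ 0 := by exact_mod_cast hx.ne'
  rw [Complex.cpow_sub _ _ hx0, Complex.cpow_one, Complex.cpow_def_of_ne_zero hx0, mul_add,
    Complex.exp_add, Complex.ofReal_log hx.le, mul_comm (Complex.log x)]
  ring

theorem hankelOut_eq (N : ℕ) (s : ℂ) {x : ℝ} (hx : 0 < x) :
    hankelOut N s x = Complex.exp ((s + N - 1) * (Real.pi * Complex.I)) *
      ((x : ℂ) ^ ((s + N - 1) - 1) * (expDiff N x)⁻¹) := by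
  rw [hankelOut, hankelIntegrand, mul_div_assoc, exp_mul_log_ofReal_add _ _ hx]
  ring

theorem hankelIn_eq (N : ℕ) (s : ℂ) {x : ℝ} (hx : 0 < x) :
    hankelIn N s x = Complex.exp ((s + N - 1) * (-(Real.pi * Complex.I))) *
      ((x : ℂ) ^ ((s + N - 1) - 1) * (expDiff N x)⁻¹) := by
  rw [hankelIn, hankelIntegrand, mul_div_assoc,
    sub_eq_add_neg (Real.log x : ℂ), exp_mul_log_ofReal_add _ _ hx]
  ring

theorem integrableOn_hankelOut (N : ℕ) {δ : ℝ} (hδ : 0 < δ) (s : ℂ) :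
    IntegrableOn (hankelOut N s) (Ioi δ) := by
  refine IntegrableOn.congr_fun ((integrableOn_cpow_mul_inv_expDiff N hδ (s + N - 1)).const_mul
    (Complex.exp ((s + N - 1) * (Real.pi * Complex.I)))) (fun x hx => ?_)
    measurableSet_Ioi
  exact (hankelOut_eq N s (hδ.trans hx)).symm

theorem integrableOn_hankelIn (N : ℕ) {δ : ℝ} (hδ : 0 < δ) (s : ℂ) :
    IntegrableOn (hankelIn N s) (Ioi δ) := by
  refine IntegrableOn.congr_fun ((integrableOn_cpow_mul_inv_expDiff N hδ (s + N - 1)).const_mul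
    (Complex.exp ((s + N - 1) * (-(Real.pi * Complex.I))))) (fun x hx => ?_)
    measurableSet_Ioi
  exact (hankelIn_eq N s (hδ.trans hx)).symm

/-- The rays carry the same function up to the phases `e^{±iπ(s+N-1)}`. -/
theorem integral_hankelOut_sub_integral_hankelIn (N : ℕ) {δ : ℝ} (hδ : 0 < δ) (s : ℂ) :
    (∫ x in Ioi δ, hankelOut N s x) - ∫ x in Ioi δ, hankelIn N s x =
      2 * Complex.I * Complex.sin (Real.pi * (s + N - 1)) *
        mellin (truncInvExpDiff N δ) (s + N - 1) := by
  rw [setIntegral_congr_fun measurableSet_Ioi fun x hx => hankelOut_eq N s (hδ.trans hx),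
    setIntegral_congr_fun measurableSet_Ioi fun x hx => hankelIn_eq N s (hδ.trans hx),
    integral_const_mul, integral_const_mul, mellin_truncInvExpDiff N hδ.le, ← sub_mul,
    Complex.sin]
  congr 1
  have h (z : ℂ) : -(Real.pi * z) * Complex.I = z * (-(Real.pi * Complex.I)) := by ring
  have h' (z : ℂ) : (Real.pi * z) * Complex.I = z * (Real.pi * Complex.I) := by ring
  rw [h, h']
  linear_combination (Complex.exp ((s + N - 1) * (-(Real.pi * Complex.I))) -
    Complex.exp ((s + N - 1) * (Real.pi * Complex.I))) * (-Complex.I_sq)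

theorem tendsto_mellin_truncInvExpDiff (N : ℕ) {s : ℂ} (hs : 1 < s.re) :
    Tendsto (fun ε : ℝ => mellin (truncInvExpDiff N ε) (s + N - 1)) (𝓝[>] 0)
      (𝓝 (∫ x in Ioi (0 : ℝ), hyperzetaIntegrand N s x)) := by
  have h := (aecover_Ioi_of_Ioi (μ := volume) (A := (0 : ℝ)) (a := fun ε : ℝ => ε)
    (l := 𝓝[>] 0) nhdsWithin_le_nhds).integral_tendsto_of_countably_generated
    (integrableOn_hyperzetaIntegrand N hs)
  refine h.congr' ?_
  filter_upwards [self_mem_nhdsWithin] with ε hε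
  have hε0 : 0 < ε := hε
  rw [mellin_truncInvExpDiff N hε0.le, Measure.restrict_restrict measurableSet_Ioi,
    Ioi_inter_Ioi, sup_of_le_left hε0.le]
  simp_rw [hyperzetaIntegrand_eq]

theorem mellin_truncInvExpDiff_succ (M : ℕ) {ε : ℝ} (hε : 0 < ε) :
    mellin (truncInvExpDiff (M + 1) ε) (M + 1) =
      ((M.factorial * (ε - Real.log (realExpDiff (M + 1) ε)) : ℝ) : ℂ) := by
  have h1 : ∀ x ∈ Ioi ε, (x : ℂ) ^ ((M + 1 : ℂ) - 1) * (expDiff (M + 1) x)⁻¹ =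
      ((x ^ M / realExpDiff (M + 1) x : ℝ) : ℂ) := fun x _ => by
    rw [add_sub_cancel_right, Complex.cpow_natCast, expDiff_ofReal]
    push_cast
    rfl
  have hint : IntegrableOn (fun x => x ^ M / realExpDiff (M + 1) x) (Ioi ε) := by
    have := (integrableOn_cpow_mul_inv_expDiff (M + 1) hε (M + 1)).congr_fun h1 measurableSet_Ioi
    exact this.re
  rw [mellin_truncInvExpDiff _ hε.le, setIntegral_congr_fun measurableSet_Ioi h1,
    integral_complex_ofReal]
  congr 1
  -- The primitive tends to `0` at infinity because `e^x - T_{N-1}(x)` is asymptotic to `e^x`.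
  have hd : ∀ x ∈ Ici ε, HasDerivAt
      (fun x => (M.factorial : ℝ) * (Real.log (realExpDiff (M + 1) x) - x))
      (x ^ M / realExpDiff (M + 1) x) x := fun x hx => by
    have hp := (realExpDiff_pos (M + 1) (hε.trans_le hx)).ne'
    refine ((((hasDerivAt_realExpDiff_succ M x).log hp).sub
      (hasDerivAt_id x)).const_mul (M.factorial : ℝ)).congr_deriv ?_
    field_simp
    ring
  rw [integral_Ioi_of_hasDerivAt_of_tendsto' hd hint
    ((tendsto_log_realExpDiff_sub (M + 1)).const_mul _)]
  ring

/-! ### The circle, and independence of the radius -/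

/-- The integrand of the contour integral in the coordinate `l = log (-w)`, in which
`dw / w = dl`. -/
noncomputable def hankelKernel (N : ℕ) (s l : ℂ) : ℂ :=
  Complex.exp ((s + N - 1) * l) / expDiff N (-Complex.exp l)

theorem hankelPoint_eq {δ : ℝ} (hδ : 0 < δ) (φ : ℝ) :
    hankelPoint δ φ = -Complex.exp (Real.log δ + φ * Complex.I) := by
  rw [hankelPoint, Complex.exp_add, ← Complex.ofReal_exp, Real.exp_log hδ]

theorem norm_hankelPoint {δ : ℝ} (hδ : 0 < δ) (φ : ℝ) : ‖hankelPoint δ φ‖ = δ := by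
  simp [hankelPoint, Complex.norm_exp_ofReal_mul_I, abs_of_pos hδ]

theorem hankelPoint_ne_zero {δ : ℝ} (hδ : 0 < δ) (φ : ℝ) : hankelPoint δ φ ≠ 0 := by
  rw [← norm_pos_iff, norm_hankelPoint hδ]
  exact hδ

theorem hankelCirc_eq (N : ℕ) {δ : ℝ} (hδ : 0 < δ) (s : ℂ) (φ : ℝ) :
    hankelCirc N δ s φ = Complex.I * hankelKernel N s (Real.log δ + φ * Complex.I) := by
  have h := hankelPoint_ne_zero hδ φ
  rw [hankelCirc, hankelIntegrand, hankelKernel, ← hankelPoint_eq hδ]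
  field_simp

theorem AdmissibleRadius.expDiff_neg_exp_ne_zero {N : ℕ} {δ : ℝ} (h : AdmissibleRadius N δ)
    {l : ℂ} (hl : l.re ≤ Real.log δ) : expDiff N (-Complex.exp l) ≠ 0 := fun h0 => by
  have := h.2 (-Complex.exp l) (by
    rw [norm_neg, Complex.norm_exp]
    exact (Real.le_log_iff_exp_le h.1).1 hl) h0
  exact Complex.exp_ne_zero l (neg_eq_zero.1 this)

theorem AdmissibleRadius.differentiableOn_hankelKernel {N : ℕ} {δ : ℝ}
    (h : AdmissibleRadius N δ) (s : ℂ) :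
    DifferentiableOn ℂ (hankelKernel N s) {l | l.re ≤ Real.log δ} := by
  refine DifferentiableOn.div (by fun_prop) ?_ fun l hl => h.expDiff_neg_exp_ne_zero hl
  exact ((differentiable_expDiff N).comp (by fun_prop : Differentiable ℂ fun l =>
    -Complex.exp l)).differentiableOn

theorem exp_smul_hankelOut_exp (N : ℕ) (s : ℂ) (t : ℝ) :
    Real.exp t • hankelOut N s (Real.exp t) = hankelKernel N s (t + Real.pi * Complex.I) := by
  have h : (Real.exp t : ℂ) ≠ 0 := by exact_mod_cast (Real.exp_pos t).ne'
  rw [hankelOut, hankelIntegrand, hankelKernel, Real.log_exp, Complex.exp_add (t : ℂ),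
    Complex.exp_pi_mul_I, ← Complex.ofReal_exp, mul_neg_one, neg_neg, Complex.real_smul]
  field_simp

theorem exp_smul_hankelIn_exp (N : ℕ) (s : ℂ) (t : ℝ) :
    Real.exp t • hankelIn N s (Real.exp t) =
      hankelKernel N s (t + (-Real.pi : ℝ) * Complex.I) := by
  have h : (Real.exp t : ℂ) ≠ 0 := by exact_mod_cast (Real.exp_pos t).ne'
  rw [hankelIn, hankelIntegrand, hankelKernel, Real.log_exp, Complex.exp_add (t : ℂ),
    Complex.ofReal_neg, neg_mul, Complex.exp_neg, Complex.exp_pi_mul_I, ← Complex.ofReal_exp,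
    Complex.real_smul, ← sub_eq_add_neg]
  norm_num
  field_simp

theorem integral_exp_smul_comp_exp {ε δ : ℝ} (hε : 0 < ε) (hδ : 0 < δ) (g : ℝ → ℂ) :
    ∫ t in Real.log ε..Real.log δ, Real.exp t • g (Real.exp t) = ∫ x in ε..δ, g x := by
  have := intervalIntegral.integral_deriv_smul_comp_of_deriv_nonneg (f := Real.exp)
    (f' := Real.exp) (g := g) (a := Real.log ε) (b := Real.log δ)
    Real.continuous_exp.continuousOn (fun x _ => Real.hasDerivAt_exp x)
    (fun x _ => (Real.exp_pos x).le)
  simpa [Real.exp_log hε, Real.exp_log hδ] using this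

theorem AdmissibleRadius.hankelI_eq {N : ℕ} {δ ε : ℝ} (h : AdmissibleRadius N δ) (hε : 0 < ε)
    (hεδ : ε ≤ δ) (s : ℂ) : hankelI N δ s = hankelI N ε s := by
  have hlog : Real.log ε ≤ Real.log δ := Real.log_le_log hε hεδ
  -- The horizontal sides are the ray segments between `ε` and `δ`, the vertical sides the two
  -- circles.
  have hrect := Complex.integral_boundary_rect_eq_zero_of_differentiableOn (hankelKernel N s)
    ⟨Real.log ε, -Real.pi⟩ ⟨Real.log δ, Real.pi⟩
    ((h.differentiableOn_hankelKernel s).mono fun l hl => by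
      have := (Complex.mem_reProdIm.1 hl).1
      rw [uIcc_of_le hlog] at this
      exact this.2)
  simp only [← exp_smul_hankelOut_exp, ← exp_smul_hankelIn_exp, smul_eq_mul] at hrect
  rw [integral_exp_smul_comp_exp hε h.1, integral_exp_smul_comp_exp hε h.1,
    ← intervalIntegral.integral_const_mul, ← intervalIntegral.integral_const_mul] at hrect
  simp only [← hankelCirc_eq N h.1, ← hankelCirc_eq N hε] at hrect
  rw [← intervalIntegral.integral_Ioi_sub_Ioi (integrableOn_hankelIn N hε s) hεδ,
    ← intervalIntegral.integral_Ioi_sub_Ioi (integrableOn_hankelOut N hε s) hεδ] at hrect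
  rw [hankelI, hankelI]
  congr 1
  linear_combination hrect

theorem AdmissibleRadius.continuous_inv_expDiff {N : ℕ} {δ : ℝ} (h : AdmissibleRadius N δ) :
    Continuous fun φ : ℝ => (expDiff N (-Complex.exp (Real.log δ + φ * Complex.I)))⁻¹ := by
  refine Continuous.inv₀ ((differentiable_expDiff N).continuous.comp (by fun_prop)) fun φ =>
    h.expDiff_neg_exp_ne_zero (by simp)

theorem AdmissibleRadius.continuous_hankelKernel_circle {N : ℕ} {δ : ℝ}
    (h : AdmissibleRadius N δ) (s : ℂ) :
    Continuous fun φ : ℝ => hankelKernel N s (Real.log δ + φ * Complex.I) := by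
  simp only [hankelKernel, div_eq_mul_inv]
  exact Continuous.mul (by fun_prop) h.continuous_inv_expDiff

theorem AdmissibleRadius.continuous_hankelCirc {N : ℕ} {δ : ℝ} (h : AdmissibleRadius N δ)
    (s : ℂ) : Continuous (hankelCirc N δ s) := by
  rw [show hankelCirc N δ s = _ from funext (hankelCirc_eq N h.1 s)]
  exact continuous_const.mul (h.continuous_hankelKernel_circle s)

theorem AdmissibleRadius.hasDerivAt_integral_hankelCirc {N : ℕ} {δ : ℝ}
    (h : AdmissibleRadius N δ) (s₀ : ℂ) :
    HasDerivAt (fun s => ∫ φ in (-Real.pi)..Real.pi, hankelCirc N δ s φ)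
      (∫ φ in (-Real.pi)..Real.pi, (Real.log δ + φ * Complex.I) * hankelCirc N δ s₀ φ) s₀ := by
  have hl : Continuous fun φ : ℝ => (Real.log δ + φ * Complex.I : ℂ) := by fun_prop
  refine (intervalIntegral.hasDerivAt_integral_of_dominated_loc_of_deriv_le
    (F' := fun s φ => (Real.log δ + φ * Complex.I) * hankelCirc N δ s φ)
    -- On the unit ball around `s₀`, `‖s + N - 1‖ ≤ ‖s₀ + N - 1‖ + 1`.
    (bound := fun φ : ℝ => ‖(Real.log δ + φ * Complex.I : ℂ)‖ *
      (Real.exp ((‖s₀ + N - 1‖ + 1) * ‖(Real.log δ + φ * Complex.I : ℂ)‖) *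
        ‖(expDiff N (-Complex.exp (Real.log δ + φ * Complex.I)))⁻¹‖))
    (Metric.ball_mem_nhds s₀ one_pos)
    (Eventually.of_forall fun s => (h.continuous_hankelCirc s).aestronglyMeasurable)
    ((h.continuous_hankelCirc s₀).intervalIntegrable _ _)
    (hl.mul (h.continuous_hankelCirc s₀)).aestronglyMeasurable
    (Eventually.of_forall fun φ _ s hs => ?_)
    (Continuous.intervalIntegrable ?_ _ _)
    (Eventually.of_forall fun φ _ s _ => ?_)).2
  · rw [hankelCirc_eq N h.1, hankelKernel, norm_mul, norm_mul, Complex.norm_I, one_mul,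
      div_eq_mul_inv, norm_mul]
    gcongr
    refine (Complex.norm_exp_le_exp_norm _).trans ?_
    rw [norm_mul]
    gcongr
    have h1 : s + N - 1 = (s₀ + N - 1) + (s - s₀) := by ring
    rw [h1]
    refine (norm_add_le _ _).trans ?_
    gcongr
    exact (mem_ball_iff_norm.1 hs).le
  · have := h.continuous_inv_expDiff.norm
    fun_prop
  · simp only [hankelCirc_eq N h.1, hankelKernel]
    have h1 : HasDerivAt (fun s : ℂ => (s + N - 1) * (Real.log δ + φ * Complex.I))
        (1 * (Real.log δ + φ * Complex.I)) s :=
      (((hasDerivAt_id s).add_const (N : ℂ)).sub_const 1).mul_const _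
    refine ((h1.cexp.div_const _).const_mul Complex.I).congr_deriv ?_
    ring

/-! ### The circle as its radius tends to zero -/

theorem hankelCirc_eq_pow_div (N : ℕ) {ε : ℝ} (hε : 0 < ε) (s : ℂ) (φ : ℝ) :
    hankelCirc N ε s φ = Complex.I * (-1) ^ N *
      Complex.exp ((s - 1) * (Real.log ε + φ * Complex.I)) *
        (hankelPoint ε φ ^ N / expDiff N (hankelPoint ε φ)) := by
  rw [hankelCirc_eq N hε, hankelKernel, ← hankelPoint_eq hε]
  have h : Complex.exp ((s + N - 1) * (Real.log ε + φ * Complex.I)) =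
      (-1) ^ N * Complex.exp ((s - 1) * (Real.log ε + φ * Complex.I)) * hankelPoint ε φ ^ N := by
    rw [hankelPoint_eq hε, neg_pow (Complex.exp _), ← Complex.exp_nat_mul, show (s + N - 1 : ℂ) *
      (Real.log ε + φ * Complex.I) = (s - 1) * (Real.log ε + φ * Complex.I) +
      N * (Real.log ε + φ * Complex.I) by ring, Complex.exp_add]
    have : ((-1 : ℂ) ^ N) * (-1) ^ N = 1 := by rw [← mul_pow]; norm_num
    linear_combination (-Complex.exp ((s - 1) * (Real.log ε + φ * Complex.I)) *
      Complex.exp (N * (Real.log ε + φ * Complex.I))) * this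
  rw [h]
  ring

/-- The quotient `w^N/(e^w - T_{N-1}(w))` stays bounded, so the integral is `O(ε^(Re s - 1))`. -/
theorem tendsto_integral_hankelCirc (N : ℕ) {s : ℂ} (hs : 1 < s.re) :
    Tendsto (fun ε : ℝ => ∫ φ in (-Real.pi)..Real.pi, hankelCirc N ε s φ) (𝓝[>] 0) (𝓝 0) := by
  obtain ⟨C, r, hC, hr, h⟩ := exists_norm_pow_div_expDiff_sub_le N
  set B : ℝ := Real.exp (|s.im| * Real.pi) * (C * r + N.factorial) with hB
  have hpow : Tendsto (fun ε : ℝ => ε ^ (s.re - 1) * B * |Real.pi - -Real.pi|) (𝓝[>] 0)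
      (𝓝 0) := by
    have h0 : Tendsto (fun ε : ℝ => ε ^ (s.re - 1)) (𝓝[>] 0) (𝓝 0) := by
      have := (Real.continuousAt_rpow_const 0 (s.re - 1) (Or.inr (by linarith))).tendsto
      rw [Real.zero_rpow (by linarith)] at this
      exact this.mono_left nhdsWithin_le_nhds
    simpa using (h0.mul_const B).mul_const |Real.pi - -Real.pi|
  refine squeeze_zero_norm' ?_ hpow
  filter_upwards [Ioc_mem_nhdsGT hr] with ε hε
  refine intervalIntegral.norm_integral_le_of_norm_le_const fun φ hφ => ?_
  rw [uIoc_of_le (by linarith [Real.pi_pos])] at hφ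
  rw [hankelCirc_eq_pow_div N hε.1, norm_mul, norm_mul, norm_mul, Complex.norm_I, norm_pow,
    norm_neg, norm_one, one_pow, one_mul, one_mul, hB, ← mul_assoc]
  have hn := norm_hankelPoint hε.1 φ
  gcongr
  · have := Real.rpow_nonneg hε.1.le (s.re - 1)
    positivity
  · rw [Complex.norm_exp, Real.rpow_def_of_pos hε.1, ← Real.exp_add]
    refine Real.exp_le_exp.2 ?_
    have h1 : -(s.im * φ) ≤ |s.im| * Real.pi := by
      refine (neg_le_abs _).trans ?_
      rw [abs_mul]
      gcongr
      exact abs_le.2 ⟨hφ.1.le, hφ.2⟩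
    simp
    linarith
  · have h2 := (h _ (hankelPoint_ne_zero hε.1 φ) (hn.trans_le hε.2)).2
    have h3 := norm_le_norm_sub_add (hankelPoint ε φ ^ N / expDiff N (hankelPoint ε φ))
      (N.factorial : ℂ)
    rw [Complex.norm_natCast] at h3
    rw [hn] at h2
    have : C * ε ≤ C * r := by gcongr; exact hε.2
    linarith

/-- Replacing the quotient by `N!` costs `O(ε (|log ε| + π))`; in the main term the part linear in
`φ` is odd and integrates to `0`. -/
theorem tendsto_integral_log_mul_hankelCirc (N : ℕ) :
    Tendsto (fun ε : ℝ => (∫ φ in (-Real.pi)..Real.pi,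
      (Real.log ε + φ * Complex.I) * hankelCirc N ε 1 φ) -
        2 * Real.pi * Complex.I * (-1) ^ N * N.factorial * Real.log ε) (𝓝[>] 0) (𝓝 0) := by
  obtain ⟨C, r, hC, hr, h⟩ := exists_norm_pow_div_expDiff_sub_le N
  have hlim : Tendsto (fun ε : ℝ => (|Real.log ε * ε| + Real.pi * ε) * C *
      |Real.pi - -Real.pi|) (𝓝[>] 0) (𝓝 0) := by
    have h1 : Tendsto (fun ε : ℝ => Real.log ε * ε) (𝓝[>] 0) (𝓝 0) := by
      simpa using tendsto_log_mul_rpow_nhdsGT_zero one_pos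
    have h2 : Tendsto (fun ε : ℝ => Real.pi * ε) (𝓝[>] 0) (𝓝 0) := by
      have : Tendsto (fun x : ℝ => Real.pi * x) (𝓝 0) (𝓝 (Real.pi * 0)) :=
        (continuous_const_mul Real.pi).tendsto 0
      rw [mul_zero] at this
      exact this.mono_left nhdsWithin_le_nhds
    simpa using ((h1.abs.add h2).mul_const C).mul_const |Real.pi - -Real.pi|
  refine squeeze_zero_norm' ?_ hlim
  filter_upwards [Ioc_mem_nhdsGT hr, (eventually_admissibleRadius N)] with ε hε hadm
  have hmain : ∫ φ in (-Real.pi)..Real.pi,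
      (Real.log ε + φ * Complex.I) * (Complex.I * (-1) ^ N * N.factorial) =
        2 * Real.pi * Complex.I * (-1) ^ N * N.factorial * Real.log ε := by
    rw [intervalIntegral.integral_mul_const, intervalIntegral.integral_add
      (by simp) (Continuous.intervalIntegrable (by fun_prop) _ _),
      intervalIntegral.integral_mul_const,
      intervalIntegral.integral_ofReal (f := fun φ => φ), integral_id,
      intervalIntegral.integral_const]
    simp
    ring
  have hcont : Continuous fun φ : ℝ =>
      (Real.log ε + φ * Complex.I : ℂ) * hankelCirc N ε 1 φ :=
    (by fun_prop : Continuous fun φ : ℝ => (Real.log ε + φ * Complex.I : ℂ)).mul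
      (hadm.continuous_hankelCirc 1)
  rw [← hmain, ← intervalIntegral.integral_sub
    (hcont.intervalIntegrable _ _)
    (Continuous.intervalIntegrable (by fun_prop) _ _)]
  refine intervalIntegral.norm_integral_le_of_norm_le_const fun φ hφ => ?_
  rw [uIoc_of_le (by linarith [Real.pi_pos])] at hφ
  have hn := norm_hankelPoint hε.1 φ
  have h2 := (h _ (hankelPoint_ne_zero hε.1 φ) (hn.trans_le hε.2)).2
  rw [hn] at h2
  rw [hankelCirc_eq_pow_div N hε.1, sub_self, zero_mul, Complex.exp_zero, mul_one, ← mul_sub,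
    ← mul_sub, norm_mul, norm_mul, norm_mul, Complex.norm_I, norm_pow, norm_neg, norm_one,
    one_pow, one_mul, one_mul]
  have h3 : ‖(Real.log ε + φ * Complex.I : ℂ)‖ ≤ |Real.log ε| + Real.pi := by
    refine (norm_add_le _ _).trans ?_
    rw [norm_mul, Complex.norm_I, mul_one, Complex.norm_real, Complex.norm_real,
      Real.norm_eq_abs, Real.norm_eq_abs]
    gcongr
    exact abs_le.2 ⟨hφ.1.le, hφ.2⟩
  calc _ ≤ (|Real.log ε| + Real.pi) * (C * ε) := by gcongr
    _ = _ := by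
      rw [abs_mul, abs_of_pos hε.1]
      ring

/-! ### Continuation, functional relation and derivative at `1` -/

theorem hankelI_eq_mellin (N : ℕ) {δ : ℝ} (hδ : 0 < δ) (s : ℂ) :
    hankelI N δ s = 1 / (2 * Real.pi * Complex.I) *
      (2 * Complex.I * Complex.sin (Real.pi * (s + N - 1)) *
        mellin (truncInvExpDiff N δ) (s + N - 1) +
          ∫ φ in (-Real.pi)..Real.pi, hankelCirc N δ s φ) := by
  rw [hankelI, ← integral_hankelOut_sub_integral_hankelIn N hδ]
  ring

theorem AdmissibleRadius.differentiable_hankelI {N : ℕ} {δ : ℝ} (h : AdmissibleRadius N δ) :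
    Differentiable ℂ (hankelI N δ) := by
  rw [show hankelI N δ = _ from funext (hankelI_eq_mellin N h.1)]
  have h1 : Differentiable ℂ fun s : ℂ => mellin (truncInvExpDiff N δ) (s + N - 1) :=
    (differentiable_mellin_truncInvExpDiff N h.1).comp (by fun_prop)
  have h2 : Differentiable ℂ fun s => ∫ φ in (-Real.pi)..Real.pi, hankelCirc N δ s φ :=
    fun s => (h.hasDerivAt_integral_hankelCirc s).differentiableAt
  fun_prop

theorem AdmissibleRadius.hankelI_eq_integral {N : ℕ} {δ : ℝ} (h : AdmissibleRadius N δ)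
    {s : ℂ} (hs : 1 < s.re) :
    hankelI N δ s = Complex.sin (Real.pi * (s + N - 1)) / Real.pi *
      ∫ x in Ioi (0 : ℝ), hyperzetaIntegrand N s x := by
  have hlim := (((tendsto_mellin_truncInvExpDiff N hs).const_mul
    (2 * Complex.I * Complex.sin (Real.pi * (s + N - 1)))).add
      (tendsto_integral_hankelCirc N hs)).const_mul (1 / (2 * Real.pi * Complex.I))
  have hconst : Tendsto (fun _ : ℝ => hankelI N δ s) (𝓝[>] 0) (𝓝 (hankelI N δ s)) :=
    tendsto_const_nhds
  have hpi : (Real.pi : ℂ) ≠ 0 := by exact_mod_cast Real.pi_ne_zero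
  rw [tendsto_nhds_unique hconst (hlim.congr' ?_)]
  · field_simp
    simp
  · filter_upwards [Ioc_mem_nhdsGT h.1] with ε hε
    rw [h.hankelI_eq hε.1 hε.2, hankelI_eq_mellin N hε.1]

theorem AdmissibleRadius.hyperzeta_eq {N : ℕ} {δ : ℝ} (h : AdmissibleRadius N δ)
    {s : ℂ} (hs : 1 < s.re) (hsn : ∀ n : ℤ, s ≠ n) :
    hyperzeta N s = Complex.Gamma (2 - s - N) * hankelI N δ s := by
  have hpi : (Real.pi : ℂ) ≠ 0 := by exact_mod_cast Real.pi_ne_zero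
  -- The sine vanishes only at integers `s`, which are excluded.
  have hsin : Complex.sin (Real.pi * (s + N - 1)) ≠ 0 := by
    rw [Complex.sin_ne_zero_iff]
    intro k hk
    refine hsn (k - N + 1) ?_
    rw [mul_comm] at hk
    have := mul_right_cancel₀ hpi hk
    push_cast
    linear_combination this
  have hG : Complex.Gamma (s + N - 1) ≠ 0 :=
    Complex.Gamma_ne_zero_of_re_pos (by simp; linarith)
  have hrefl := Complex.Gamma_mul_Gamma_one_sub (s + N - 1)
  rw [show (1 - (s + N - 1) : ℂ) = 2 - s - N by ring] at hrefl
  have hG2 : Complex.Gamma (2 - s - N) =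
      Real.pi / Complex.sin (Real.pi * (s + N - 1)) / Complex.Gamma (s + N - 1) := by
    rw [eq_div_iff hG, mul_comm, hrefl]
  rw [h.hankelI_eq_integral hs, hyperzeta, hG2]
  generalize Complex.sin (Real.pi * (s + N - 1)) = S at hsin ⊢
  field_simp

theorem AdmissibleRadius.hasDerivAt_hankelI_one_aux {M : ℕ} {δ : ℝ}
    (h : AdmissibleRadius (M + 1) δ) :
    HasDerivAt (hankelI (M + 1) δ)
      ((-1) ^ (M + 1) * ((M.factorial * (δ - Real.log (realExpDiff (M + 1) δ)) : ℝ) : ℂ) +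
        1 / (2 * Real.pi * Complex.I) * ∫ φ in (-Real.pi)..Real.pi,
          (Real.log δ + φ * Complex.I) * hankelCirc (M + 1) δ 1 φ) 1 := by
  have hpi : (Real.pi : ℂ) ≠ 0 := by exact_mod_cast Real.pi_ne_zero
  rw [show hankelI (M + 1) δ = _ from funext (hankelI_eq_mellin (M + 1) h.1)]
  have h0 : HasDerivAt (fun s : ℂ => s + (M + 1 : ℕ) - 1) 1 1 :=
    ((hasDerivAt_id (1 : ℂ)).add_const _).sub_const 1
  have hz : (1 : ℂ) + (M + 1 : ℕ) - 1 = M + 1 := by push_cast; ring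
  have h1 := ((differentiable_mellin_truncInvExpDiff (M + 1) h.1
    ((1 : ℂ) + (M + 1 : ℕ) - 1)).hasDerivAt).comp (h := fun s : ℂ => s + (M + 1 : ℕ) - 1)
      (1 : ℂ) h0
  have h2 := ((h0.const_mul (Real.pi : ℂ)).csin).const_mul (2 * Complex.I)
  have hsin : Complex.sin (Real.pi * (M + 1)) = 0 := by
    have := Complex.sin_nat_mul_pi (M + 1)
    rw [mul_comm]
    exact_mod_cast this
  have hcos : Complex.cos (Real.pi * (M + 1)) = (-1) ^ (M + 1) := by
    have := Real.cos_nat_mul_pi (M + 1)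
    rw [mul_comm]
    exact_mod_cast congrArg Complex.ofReal this
  refine (((h2.mul h1).add (h.hasDerivAt_integral_hankelCirc 1)).const_mul
    (1 / (2 * Real.pi * Complex.I))).congr_deriv ?_
  simp only [Function.comp_apply, hz, hsin, hcos, mellin_truncInvExpDiff_succ M h.1]
  field_simp
  ring

theorem AdmissibleRadius.hasDerivAt_hankelI_one {N : ℕ} (hN : 1 ≤ N) {δ : ℝ}
    (h : AdmissibleRadius N δ) :
    HasDerivAt (hankelI N δ)
      ((-1) ^ N * ((N - 1).factorial : ℂ) * (Real.log (N.factorial : ℝ) : ℂ)) 1 := by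
  obtain ⟨M, rfl⟩ := Nat.exists_eq_add_of_le' hN
  have hpi : (Real.pi : ℂ) ≠ 0 := by exact_mod_cast Real.pi_ne_zero
  set D := deriv (hankelI (M + 1) δ) 1 with hD
  have hreal : Tendsto (fun ε : ℝ => ε + Real.log (ε ^ (M + 1) / realExpDiff (M + 1) ε))
      (𝓝[>] 0) (𝓝 (0 + Real.log ((M + 1).factorial : ℝ))) :=
    (tendsto_id.mono_left nhdsWithin_le_nhds).add
      ((tendsto_pow_div_realExpDiff (M + 1)).log (by positivity))
  rw [zero_add] at hreal
  have hlim := ((((Complex.continuous_ofReal.tendsto _).comp hreal).const_mul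
    ((-1) ^ (M + 1) * (M.factorial : ℂ))).add
      ((tendsto_integral_log_mul_hankelCirc (M + 1)).const_mul (1 / (2 * Real.pi * Complex.I))))
  have hconst : Tendsto (fun _ : ℝ => D) (𝓝[>] 0) (𝓝 D) := tendsto_const_nhds
  have key := tendsto_nhds_unique hconst (hlim.congr' ?_)
  · rw [mul_zero, add_zero] at key
    rw [Nat.add_sub_cancel, ← key]
    exact (h.differentiable_hankelI 1).hasDerivAt
  · filter_upwards [Ioc_mem_nhdsGT h.1] with ε hε
    -- Equality as functions of `s` lets the derivative be computed with any smaller radius.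
    have hfun : hankelI (M + 1) δ = hankelI (M + 1) ε := funext (h.hankelI_eq hε.1 hε.2)
    rw [hD, hfun, (h.mono hε.1 hε.2).hasDerivAt_hankelI_one_aux.deriv, Function.comp_apply,
      Real.log_div (pow_pos hε.1 _).ne' (realExpDiff_pos _ hε.1).ne', Real.log_pow,
      Nat.factorial_succ]
    push_cast
    field_simp
    ring

theorem theorem3p4 (N : ℕ) (hN : 1 ≤ N) :
    (∀ᶠ δ in 𝓝[>] (0 : ℝ), AdmissibleRadius N δ) ∧
    ∀ δ : ℝ, AdmissibleRadius N δ →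
      -- the contour integral converges for every `s`, and is an entire function of `s`
      (∀ s : ℂ, IntegrableOn (hankelIn N s) (Ioi δ) ∧
        IntervalIntegrable (hankelCirc N δ s) volume (-Real.pi) Real.pi ∧
        IntegrableOn (hankelOut N s) (Ioi δ)) ∧
      Differentiable ℂ (hankelI N δ) ∧
      -- its relation to the hypergeometric zeta function
      (∀ s : ℂ, 1 < s.re →
        IntegrableOn (hyperzetaIntegrand N s) (Ioi 0) ∧
        ((∀ n : ℤ, s ≠ n) →
          hyperzeta N s = Complex.Gamma (2 - s - N) * hankelI N δ s)) ∧
      -- its derivative at `1`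
      HasDerivAt (hankelI N δ)
        ((-1) ^ N * ((N - 1).factorial : ℂ) * (Real.log (N.factorial : ℝ) : ℂ)) 1 :=
  ⟨eventually_admissibleRadius N, fun _ h =>
    ⟨fun s => ⟨integrableOn_hankelIn N h.1 s, (h.continuous_hankelCirc s).intervalIntegrable _ _,
      integrableOn_hankelOut N h.1 s⟩, h.differentiable_hankelI,
      fun _ hs => ⟨integrableOn_hyperzetaIntegrand N hs, h.hyperzeta_eq hs⟩,
      h.hasDerivAt_hankelI_one hN⟩⟩
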